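/- **Abstract Modular Stone–von Neumann Theorem.** Let $A$ and $B$ be $C^*$-algebras. A *$B$–$A$ correspondence* is a (right) Hilbert $A$-module $X$ with a $*$-homomorphism $\phi_X : B \to \mathcal L(X)$ into the adjointable operators on $X$ that is nondegenerate, i.e. $\{\phi_X(b)x : b \in B,\ x \in X\} = X$. It is a *$B$–$A$ imprimitivity bimodule* if $\phi_X$ is an isomorphism of $B$ onto $\mathcal K(X)$, the closed linear span in operator norm of the operators $\theta_{x,y} : z \mapsto x\langle y, z\rangle_A$ $(x,y \in X)$. For a set $I$, $\bigoplus_I X$ denotes the Hilbert $A$-module of all families $(x_i)_{i\in I}$ in $X$ such that $\sum_i \langle x_i, x_i\rangle_A$ converges in norm, with $\langle (x_i),(y_i)\rangle_A = \sum_i \langle x_i,y_i\rangle_A$ and with $A$ and $B$ acting coordinatewise. An *isomorphism* of $B$–$A$ correspondences is a linear bijection that preserves the $A$-valued inner products and intertwines the actions of $B$. Suppose that $A$ is elementary, i.e. isomorphic to the $C^*$-algebra $\mathcal K(H)$ of compact operators on some nonzero Hilbert space $H$, and that $X$ is a $B$–$A$ imprimitivity bimodule. Then every $B$–$A$ correspondence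 $Y$ is a multiple of $X$: there is a set $I$ such that $Y \cong \bigoplus_I X$ as $B$–$A$ correspondences. -/

import Mathlib

open scoped InnerProductSpace

universe u u' v v' w

set_option linter.unusedSectionVars false

/-! ### Hilbert modules

Mathlib's class `CStarModule C X` has the axioms `⟪x, c • y⟫ = c * ⟪x, y⟫` and
`star ⟪x, y⟫ = ⟪y, x⟫`, so it describes *left* modules over `C`.  A right Hilbert `A`-module, with
`⟪x, y a⟫ = ⟪x, y⟫ a`, is therefore a complete `CStarModule Aᵐᵒᵖ X`: there `x a` is
`MulOpposite.op a • x`, and the `A`-valued inner product of `x` and `y` is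
`(⟪x, y⟫_Aᵐᵒᵖ).unop`.  The general constructions below are made for an arbitrary C⋆-algebra `C`;
they will be used with `C = Aᵐᵒᵖ`. -/

namespace HilbertModule

open CStarModule

section Basic

variable {C : Type u} [NonUnitalCStarAlgebra C] [PartialOrder C] [StarOrderedRing C]
variable {X : Type v} [NormedAddCommGroup X] [NormedSpace ℂ X] [SMul C X] [CStarModule C X]

variable (C) in
lemma ext_inner {x y : X} (h : ∀ z : X, ⟪z, x⟫_C = ⟪z, y⟫_C) : x = y := by
  have h0 : ⟪x - y, x - y⟫_C = 0 := by
    rw [CStarModule.inner_sub_right (A := C), h, sub_self]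
  exact sub_eq_zero.mp (inner_self.mp h0)

lemma op_smul_add (c d : C) (x : X) : (c + d) • x = c • x + d • x :=
  ext_inner C fun z => by simp [add_mul]

lemma op_smul_complex (r : ℂ) (c : C) (x : X) : (r • c) • x = r • (c • x) :=
  ext_inner C fun z => by simp [smul_mul_assoc]

lemma norm_op_smul_le (c : C) (x : X) : ‖c • x‖ ≤ ‖c‖ * ‖x‖ := by
  refine (sq_le_sq₀ (norm_nonneg _) (by positivity)).mp ?_
  rw [mul_pow, norm_sq_eq C (E := X), norm_sq_eq C (E := X)]
  simp only [inner_op_smul_right, inner_op_smul_left]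
  calc ‖c * (⟪x, x⟫_C * star c)‖ ≤ ‖c‖ * (‖⟪x, x⟫_C‖ * ‖star c‖) :=
        (norm_mul_le _ _).trans (by gcongr; exact norm_mul_le _ _)
    _ = ‖c‖ ^ 2 * ‖⟪x, x⟫_C‖ := by rw [norm_star]; ring

variable (C) in
/-- The operator `θ_{x,y} : z ↦ x ⟪y, z⟫` on a Hilbert module. -/
noncomputable def rankOne (x y : X) : X →L[ℂ] X :=
  LinearMap.mkContinuous
    { toFun := fun z => ⟪y, z⟫_C • x
      map_add' := fun z z' => by rw [CStarModule.inner_add_right, op_smul_add]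
      map_smul' := fun r z => by
        rw [inner_smul_right_complex, op_smul_complex, RingHom.id_apply] }
    (‖y‖ * ‖x‖) fun z => by
      refine (norm_op_smul_le _ x).trans ?_
      calc ‖⟪y, z⟫_C‖ * ‖x‖ ≤ (‖y‖ * ‖z‖) * ‖x‖ := by gcongr; exact norm_inner_le X
        _ = ‖y‖ * ‖x‖ * ‖z‖ := by ring

variable (C X) in
/-- The algebra `𝓚(X)` of compact operators on a Hilbert module: the closed linear span, for the
operator norm, of the operators `θ_{x,y}`. -/
noncomputable def compacts : Submodule ℂ (X →L[ℂ] X) :=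
  (Submodule.span ℂ {T | ∃ x y : X, T = rankOne C x y}).topologicalClosure

/-! ### The direct sum of copies of a Hilbert module -/

lemma summable_of_nonneg_of_le {I : Type w} {f g : I → C} (h0 : ∀ i, 0 ≤ f i)
    (hfg : ∀ i, f i ≤ g i) (hg : Summable g) : Summable f := by
  rw [summable_iff_vanishing_norm] at hg ⊢
  intro ε hε
  obtain ⟨s, hs⟩ := hg ε hε
  refine ⟨s, fun t ht => lt_of_le_of_lt ?_ (hs t ht)⟩
  exact CStarAlgebra.norm_le_norm_of_nonneg_of_le (Finset.sum_nonneg fun i _ => h0 i)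
    (Finset.sum_le_sum fun i _ => hfg i)

lemma inner_add_self_le (x y : X) :
    ⟪x + y, x + y⟫_C ≤ (2 : ℝ) • ⟪x, x⟫_C + (2 : ℝ) • ⟪y, y⟫_C := by
  have h : 0 ≤ ⟪x - y, x - y⟫_C := CStarModule.inner_self_nonneg
  have e : (2 : ℝ) • ⟪x, x⟫_C + (2 : ℝ) • ⟪y, y⟫_C
      = ⟪x + y, x + y⟫_C + ⟪x - y, x - y⟫_C := by
    simp only [CStarModule.inner_add_left, CStarModule.inner_add_right, CStarModule.inner_sub_left, CStarModule.inner_sub_right, two_smul]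
    abel
  rw [e]
  exact le_add_of_nonneg_right h

variable (C X) in
/-- The families `x : I → X` such that `∑ i, ⟪x i, x i⟫` converges (unconditionally, in norm). -/
def sumCarrier (I : Type w) : Submodule ℂ (I → X) where
  carrier := {x | Summable fun i => ⟪x i, x i⟫_C}
  zero_mem' := by simp
  add_mem' {x y} hx hy :=
    summable_of_nonneg_of_le (fun _ => CStarModule.inner_self_nonneg) (fun i => inner_add_self_le (x i) (y i))
      ((hx.const_smul (2 : ℝ)).add (hy.const_smul (2 : ℝ)))
  smul_mem' r x hx := by
    simpa using (hx.const_smul (star r)).const_smul r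

variable (C X) in
/-- The direct sum `⨁_I X` of copies of the Hilbert module `X`: the families `x : I → X` such that
`∑ i, ⟪x i, x i⟫` converges, with the coordinatewise operations and the inner product
`⟪x, y⟫ = ∑ i, ⟪x i, y i⟫`. -/
def HilbertSum (I : Type w) : Type (max v w) := sumCarrier C X I

namespace HilbertSum

variable {I : Type w}

instance : AddCommGroup (HilbertSum C X I) := inferInstanceAs (AddCommGroup (sumCarrier C X I))

instance : Module ℂ (HilbertSum C X I) := inferInstanceAs (Module ℂ (sumCarrier C X I))

/-- The element of the direct sum given by a family. -/
def mk (x : I → X) (hx : Summable fun i => ⟪x i, x i⟫_C) : HilbertSum C X I :=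
  (⟨x, hx⟩ : sumCarrier C X I)

/-- The family underlying an element of the direct sum. -/
def coord (x : HilbertSum C X I) : I → X := Subtype.val (p := (· ∈ sumCarrier C X I)) x

instance : CoeFun (HilbertSum C X I) fun _ => I → X := ⟨coord⟩

@[simp] lemma mk_apply (x : I → X) (hx : Summable fun i => ⟪x i, x i⟫_C) (i : I) :
    mk x hx i = x i := rfl

@[ext] lemma ext {x y : HilbertSum C X I} (h : ∀ i, x i = y i) : x = y := Subtype.ext (funext h)

lemma summable_inner_self (x : HilbertSum C X I) : Summable fun i => ⟪x i, x i⟫_C := x.property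

@[simp] lemma add_apply (x y : HilbertSum C X I) (i : I) : (x + y) i = x i + y i := rfl

@[simp] lemma smul_apply (r : ℂ) (x : HilbertSum C X I) (i : I) : (r • x) i = r • x i := rfl

@[simp] lemma zero_apply (i : I) : (0 : HilbertSum C X I) i = 0 := rfl

@[simp] lemma sub_apply (x y : HilbertSum C X I) (i : I) : (x - y) i = x i - y i := rfl

instance : SMul C (HilbertSum C X I) where
  smul c x := mk (fun i => c • x i) <| by
    have h := (x.summable_inner_self.mul_right (star c)).mul_left c
    simpa only [inner_op_smul_right, inner_op_smul_left] using h

@[simp] lemma op_smul_apply (c : C) (x : HilbertSum C X I) (i : I) : (c • x) i = c • x i := rfl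

lemma summable_inner (x y : HilbertSum C X I) : Summable fun i => ⟪x i, y i⟫_C := by
  have hx := summable_inner_self x
  have hy := summable_inner_self y
  have p := ((summable_inner_self (x + y)).sub hx).sub hy
  have q := ((summable_inner_self (x + Complex.I • y)).sub hx).sub hy
  have h := (p.sub (q.const_smul Complex.I)).const_smul (1 / 2 : ℂ)
  refine h.congr fun i => ?_
  simp only [add_apply, smul_apply, CStarModule.inner_add_left, CStarModule.inner_add_right, inner_smul_left_complex,
    inner_smul_right_complex, smul_sub, smul_add, smul_smul, Complex.star_def, Complex.conj_I]
  have e : Complex.I * Complex.I = -1 := Complex.I_mul_I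
  simp only [mul_neg, e, mul_one, neg_neg, neg_smul]
  module

noncomputable instance : Norm (HilbertSum C X I) where
  norm x := √‖∑' i, ⟪x i, x i⟫_C‖

noncomputable instance : CStarModule C (HilbertSum C X I) where
  inner x y := ∑' i, ⟪x i, y i⟫_C
  inner_add_right {x y z} := by
    simpa using (summable_inner x y).tsum_add (summable_inner x z)
  inner_self_nonneg := tsum_nonneg fun _ => CStarModule.inner_self_nonneg
  inner_self {x} := by
    constructor
    · intro h
      have h0 : HasSum (fun i => ⟪x i, x i⟫_C) 0 := h ▸ (summable_inner_self x).hasSum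
      rw [hasSum_zero_iff_of_nonneg fun _ => CStarModule.inner_self_nonneg] at h0
      ext i
      exact inner_self.mp (congrFun h0 i)
    · rintro rfl
      simp
  inner_op_smul_right {c x y} := by
    simpa using (summable_inner x y).tsum_mul_left c
  inner_smul_right_complex {r x y} := by
    simpa using (summable_inner x y).tsum_const_smul r
  star_inner x y := by
    rw [tsum_star]
    simp
  norm_eq_sqrt_norm_inner_self x := rfl

lemma inner_def (x y : HilbertSum C X I) : ⟪x, y⟫_C = ∑' i, ⟪x i, y i⟫_C := rfl

noncomputable instance : NormedAddCommGroup (HilbertSum C X I) := CStarModule.normedAddCommGroup C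

noncomputable instance : NormedSpace ℂ (HilbertSum C X I) := .ofCore (CStarModule.normedSpaceCore C)

lemma norm_sum_le (x : HilbertSum C X I) (s : Finset I) :
    ‖∑ i ∈ s, ⟪x i, x i⟫_C‖ ≤ ‖x‖ ^ 2 := by
  rw [norm_sq_eq C]
  exact CStarAlgebra.norm_le_norm_of_nonneg_of_le (Finset.sum_nonneg fun i _ => CStarModule.inner_self_nonneg)
    ((summable_inner_self x).sum_le_tsum s fun i _ => CStarModule.inner_self_nonneg)

lemma norm_apply_le (x : HilbertSum C X I) (i : I) : ‖x i‖ ≤ ‖x‖ := by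
  refine (sq_le_sq₀ (norm_nonneg _) (norm_nonneg _)).mp ?_
  rw [norm_sq_eq C (E := X)]
  simpa using norm_sum_le x {i}

instance [CompleteSpace X] : CompleteSpace (HilbertSum C X I) := by
  refine Metric.complete_of_cauchySeq_tendsto fun f hf => ?_
  have hc : ∀ i, CauchySeq fun n => f n i := fun i => by
    rw [Metric.cauchySeq_iff] at hf ⊢
    intro ε hε
    obtain ⟨N, hN⟩ := hf ε hε
    refine ⟨N, fun m hm n hn => lt_of_le_of_lt ?_ (hN m hm n hn)⟩
    rw [dist_eq_norm, dist_eq_norm, ← sub_apply]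
    exact norm_apply_le _ i
  choose g hg using fun i => cauchySeq_tendsto_of_complete (hc i)
  have key : ∀ ε : ℝ, 0 < ε → ∃ N, ∀ n ≥ N, ∀ s : Finset I,
      ‖∑ i ∈ s, ⟪g i - f n i, g i - f n i⟫_C‖ ≤ ε ^ 2 := by
    intro ε hε
    obtain ⟨N, hN⟩ := Metric.cauchySeq_iff.mp hf ε hε
    refine ⟨N, fun n hn s => ?_⟩
    have hlim : Filter.Tendsto (fun m => ‖∑ i ∈ s, ⟪f m i - f n i, f m i - f n i⟫_C‖)
        Filter.atTop (nhds ‖∑ i ∈ s, ⟪g i - f n i, g i - f n i⟫_C‖) := by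
      refine (tendsto_finsetSum _ fun i _ => ?_).norm
      have h1 := (hg i).sub_const (f n i)
      exact ((continuous_inner (A := C) (E := X)).tendsto _).comp (h1.prodMk_nhds h1)
    refine le_of_tendsto hlim (Filter.eventually_atTop.mpr ⟨N, fun m hm => ?_⟩)
    refine (norm_sum_le (f m - f n) s).trans ?_
    have := hN m hm n hn
    rw [dist_eq_norm] at this
    gcongr
  have gmem : Summable fun i => ⟪g i, g i⟫_C := by
    rw [summable_iff_vanishing_norm]
    intro ε hε
    obtain ⟨N, hN⟩ := key (√(ε / 8)) (by positivity)
    obtain ⟨s, hs⟩ := summable_iff_vanishing_norm.mp (summable_inner_self (f N)) (ε / 8)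
      (by positivity)
    refine ⟨s, fun t ht => ?_⟩
    have h1 := hN N le_rfl t
    have h2 := hs t ht
    rw [Real.sq_sqrt (by positivity)] at h1
    have h3 : ‖∑ i ∈ t, ⟪g i, g i⟫_C‖ ≤
        ‖(2 : ℝ) • ∑ i ∈ t, ⟪g i - f N i, g i - f N i⟫_C
          + (2 : ℝ) • ∑ i ∈ t, ⟪f N i, f N i⟫_C‖ := by
      refine CStarAlgebra.norm_le_norm_of_nonneg_of_le
        (Finset.sum_nonneg fun i _ => CStarModule.inner_self_nonneg) ?_
      rw [Finset.smul_sum, Finset.smul_sum, ← Finset.sum_add_distrib]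
      refine Finset.sum_le_sum fun i _ => ?_
      simpa using inner_add_self_le (C := C) (g i - f N i) (f N i)
    refine h3.trans_lt ((norm_add_le _ _).trans_lt ?_)
    rw [norm_smul, norm_smul, Real.norm_ofNat]
    linarith
  refine ⟨mk g gmem, ?_⟩
  set g' : HilbertSum C X I := mk g gmem with hg'
  rw [Metric.tendsto_atTop]
  intro ε hε
  obtain ⟨N, hN⟩ := key (ε / 2) (by positivity)
  refine ⟨N, fun n hn => ?_⟩
  rw [dist_comm, dist_eq_norm]
  have h : ‖g' - f n‖ ^ 2 ≤ (ε / 2) ^ 2 := by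
    rw [norm_sq_eq C]
    exact le_of_tendsto (summable_inner_self (g' - f n)).hasSum.norm
      (Filter.Eventually.of_forall fun s => hN n hn s)
  have := (sq_le_sq₀ (norm_nonneg _) (by positivity)).mp h
  linarith

end HilbertSum

end Basic

/-! ### Representations and correspondences -/

section Correspondence

variable (B : Type u') (A : Type u) [NonUnitalCStarAlgebra B] [NonUnitalCStarAlgebra A]
  [PartialOrder A] [StarOrderedRing A]
variable (X : Type v) [NormedAddCommGroup X] [NormedSpace ℂ X] [SMul Aᵐᵒᵖ X] [CStarModule Aᵐᵒᵖ X]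

/-- A ⋆-homomorphism `φ : B → 𝓛(X)` into the adjointable operators on the right Hilbert
`A`-module `X`: an algebra homomorphism into the bounded operators such that `φ(b⋆)` is an adjoint
of `φ(b)` for the `A`-valued inner product. -/
structure AdjointableRep where
  toHom : B →ₙₐ[ℂ] (X →L[ℂ] X)
  inner_left : ∀ (b : B) (x y : X), ⟪toHom b x, y⟫_Aᵐᵒᵖ = ⟪x, toHom (star b) y⟫_Aᵐᵒᵖ

/-- A `B`-`A` correspondence structure on the right Hilbert `A`-module `X`: a ⋆-homomorphism
`φ : B → 𝓛(X)` that is nondegenerate, `{φ(b) x : b ∈ B, x ∈ X} = X`. -/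
structure Correspondence extends AdjointableRep B A X where
  nondegenerate : {y : X | ∃ (b : B) (x : X), y = toHom b x} = Set.univ

variable {B A X}

/-- A `B`-`A` imprimitivity bimodule is a `B`-`A` correspondence `X` such that `φ` is an isomorphism
of `B` onto `𝓚(X)`. -/
def Correspondence.IsImprimitivityBimodule (φ : Correspondence B A X) : Prop :=
  Function.Injective φ.toHom ∧ Set.range φ.toHom = (compacts Aᵐᵒᵖ X : Set (X →L[ℂ] X))

namespace AdjointableRep

lemma inner_self_le (φ : AdjointableRep B A X) (b : B) (x : X) :
    ⟪φ.toHom b x, φ.toHom b x⟫_Aᵐᵒᵖ ≤ (‖b‖ ^ 2) • ⟪x, x⟫_Aᵐᵒᵖ := by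
  let _ : PartialOrder (Unitization ℂ B) := CStarAlgebra.spectralOrder _
  let _ : StarOrderedRing (Unitization ℂ B) := CStarAlgebra.spectralOrderedRing _
  have hpos : (0 : Unitization ℂ B) ≤
      algebraMap ℝ _ (‖b‖ ^ 2) - star (b : Unitization ℂ B) * (b : Unitization ℂ B) := by
    rw [sub_nonneg]
    have := CStarAlgebra.star_mul_le_algebraMap_norm_sq (a := (b : Unitization ℂ B))
    rwa [Unitization.norm_inr] at this
  obtain ⟨s, hs⟩ := CStarAlgebra.nonneg_iff_eq_star_mul_self.mp hpos
  have hl : algebraMap ℝ (Unitization ℂ B) (‖b‖ ^ 2)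
      - star (b : Unitization ℂ B) * (b : Unitization ℂ B)
      = Unitization.inl ((‖b‖ ^ 2 : ℝ) : ℂ) + ((-(star b * b) : B) : Unitization ℂ B) := by
    rw [IsScalarTower.algebraMap_apply ℝ ℂ (Unitization ℂ B), ← Unitization.inr_star,
      ← Unitization.inr_mul, Unitization.inr_neg, sub_eq_add_neg, Unitization.algebraMap_eq_inl]
    rfl
  rw [hl] at hs
  have h1 := congrArg (fun z => z.fst) hs
  have h2 := congrArg (fun z => z.snd) hs
  obtain ⟨r, e⟩ := s
  have h1' : star r * r = ((‖b‖ ^ 2 : ℝ) : ℂ) := by simpa using h1.symm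
  have h2' : star r • e + r • star e + star e * e = -(star b * b) := by simpa using h2.symm
  have hS : ⟪r • x + φ.toHom e x, r • x + φ.toHom e x⟫_Aᵐᵒᵖ
      = (‖b‖ ^ 2) • ⟪x, x⟫_Aᵐᵒᵖ - ⟪φ.toHom b x, φ.toHom b x⟫_Aᵐᵒᵖ := by
    have e1 : ⟪r • x + φ.toHom e x, r • x + φ.toHom e x⟫_Aᵐᵒᵖ
        = (star r * r) • ⟪x, x⟫_Aᵐᵒᵖ
          + ⟪x, φ.toHom (star r • e + r • star e + star e * e) x⟫_Aᵐᵒᵖ := by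
      simp only [CStarModule.inner_add_left, CStarModule.inner_add_right, inner_smul_left_complex,
        inner_smul_right_complex, φ.inner_left, map_add, map_smul, map_mul,
        _root_.add_apply, _root_.smul_apply,
        _root_.mul_apply_eq_comp, smul_add, smul_smul]
      module
    rw [e1, h1', h2', map_neg, map_mul, _root_.neg_apply,
      _root_.mul_apply_eq_comp, CStarModule.inner_neg_right, φ.inner_left, Complex.coe_smul]
    abel
  rw [← sub_nonneg, ← hS]
  exact CStarModule.inner_self_nonneg

/-- The operator `(x i)ᵢ ↦ (φ(b) (x i))ᵢ` on the direct sum `⨁_I X`, as a map. -/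
noncomputable def sumMap (φ : AdjointableRep B A X) (I : Type w) (b : B) (x : HilbertSum Aᵐᵒᵖ X I) :
    HilbertSum Aᵐᵒᵖ X I :=
  HilbertSum.mk (fun i => φ.toHom b (x i))
    (summable_of_nonneg_of_le (fun _ => CStarModule.inner_self_nonneg)
      (fun i => φ.inner_self_le b (x i)) (x.summable_inner_self.const_smul (‖b‖ ^ 2)))

@[simp]
lemma sumMap_apply (φ : AdjointableRep B A X) (I : Type w) (b : B) (x : HilbertSum Aᵐᵒᵖ X I)
    (i : I) : φ.sumMap I b x i = φ.toHom b (x i) := rfl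

lemma norm_sumMap_le (φ : AdjointableRep B A X) (I : Type w) (b : B) (x : HilbertSum Aᵐᵒᵖ X I) :
    ‖φ.sumMap I b x‖ ≤ ‖b‖ * ‖x‖ := by
  refine (sq_le_sq₀ (norm_nonneg _) (by positivity)).mp ?_
  have e : ‖b‖ ^ 2 * ‖⟪x, x⟫_Aᵐᵒᵖ‖ = ‖(‖b‖ ^ 2) • ⟪x, x⟫_Aᵐᵒᵖ‖ := by
    rw [norm_smul, Real.norm_of_nonneg (sq_nonneg ‖b‖)]
  rw [mul_pow, norm_sq_eq Aᵐᵒᵖ, norm_sq_eq Aᵐᵒᵖ (E := HilbertSum Aᵐᵒᵖ X I), e]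
  refine CStarAlgebra.norm_le_norm_of_nonneg_of_le CStarModule.inner_self_nonneg ?_
  rw [HilbertSum.inner_def, HilbertSum.inner_def,
    ← x.summable_inner_self.tsum_const_smul (‖b‖ ^ 2)]
  exact Summable.tsum_le_tsum (fun i => φ.inner_self_le b (x i))
    (HilbertSum.summable_inner_self _) (x.summable_inner_self.const_smul (‖b‖ ^ 2))

/-- The coordinatewise action of `B` on the direct sum `⨁_I X`: `b (x i)ᵢ = (b (x i))ᵢ`. -/
noncomputable def sum (φ : AdjointableRep B A X) (I : Type w) :
    AdjointableRep B A (HilbertSum Aᵐᵒᵖ X I) where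
  toHom :=
    { toFun := fun b => LinearMap.mkContinuous
        { toFun := φ.sumMap I b
          map_add' := fun x y => HilbertSum.ext fun i => by simp
          map_smul' := fun r x => HilbertSum.ext fun i => by simp }
        ‖b‖ (φ.norm_sumMap_le I b)
      map_smul' := fun r b => ContinuousLinearMap.ext fun x => HilbertSum.ext fun i => by simp
      map_zero' := ContinuousLinearMap.ext fun x => HilbertSum.ext fun i => by simp
      map_add' := fun b c => ContinuousLinearMap.ext fun x => HilbertSum.ext fun i => by simp
      map_mul' := fun b c => ContinuousLinearMap.ext fun x => HilbertSum.ext fun i => by simp }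
  inner_left b x y := tsum_congr fun i => φ.inner_left b (x i) (y i)

@[simp]
lemma sum_apply (φ : AdjointableRep B A X) (I : Type w) (b : B) (x : HilbertSum Aᵐᵒᵖ X I) (i : I) :
    (φ.sum I).toHom b x i = φ.toHom b (x i) := rfl

variable {Y : Type w} [NormedAddCommGroup Y] [NormedSpace ℂ Y] [SMul Aᵐᵒᵖ Y] [CStarModule Aᵐᵒᵖ Y]

/-- An isomorphism of `B`-`A` correspondences: a linear bijection that preserves the `A`-valued
inner products and intertwines the actions of `B`. -/
structure Iso (φ : AdjointableRep B A X) (ψ : AdjointableRep B A Y) extends X ≃ₗ[ℂ] Y where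
  inner_map : ∀ x y : X, ⟪toFun x, toFun y⟫_Aᵐᵒᵖ = ⟪x, y⟫_Aᵐᵒᵖ
  map_rep : ∀ (b : B) (x : X), toFun (φ.toHom b x) = ψ.toHom b (toFun x)

end AdjointableRep

variable {Y : Type w} [NormedAddCommGroup Y] [NormedSpace ℂ Y] [SMul Aᵐᵒᵖ Y] [CStarModule Aᵐᵒᵖ Y]

/-- The correspondence `Y` is a multiple of the correspondence `X`: for some set `I`, it is
isomorphic to the direct sum `⨁_I X`. -/
def Correspondence.IsMultipleOf (ψ : Correspondence B A Y) (φ : Correspondence B A X) : Prop :=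
  ∃ I : Type w, Nonempty (ψ.toAdjointableRep.Iso (φ.toAdjointableRep.sum I))

end Correspondence

/-- A C⋆-algebra `A` is elementary if it is isomorphic to the algebra `𝓚(H)` of compact operators on
a nonzero Hilbert space `H`, that is, if there is an injective ⋆-homomorphism from `A` to the
bounded operators on `H` whose range consists of all compact operators. -/
def IsElementary (A : Type u) [NonUnitalCStarAlgebra A] : Prop :=
  ∃ (H : Type v) (_ : NormedAddCommGroup H) (_ : InnerProductSpace ℂ H) (_ : CompleteSpace H)
    (π : A →⋆ₙₐ[ℂ] (H →L[ℂ] H)), Nontrivial H ∧ Function.Injective π ∧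
      Set.range π = {T : H →L[ℂ] H | IsCompactOperator T}

end HilbertModule

/-! ### Compact operators and a minimal full projection in an elementary algebra. -/

namespace HilbertModule

/-! A rank-one projection `p` of `A` satisfies `p A p = ℂ p` and generates `A` as a closed ideal. If
`X ≠ 0`, then `X p ≠ 0`, so some `e` in `X p` has `⟪e, e⟫ = p`. As `φ` maps `B` isomorphically onto
`𝓚(X)`, some `q` in `B` has `φ(q) = θ_{e,e}`. Then `q` is again a projection with `q B q = ℂ q` that
generates `B`, and `q b q` and `⟪e, φ(b) e⟫` are the same multiple of `q` and of `p`
(`exists_corner`).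

For a correspondence `Y`, the closed subspace `K = ψ(q) Y p` has inner products in `ℂ p`, so it is a
Hilbert space. An orthonormal basis `(f i)` of it gives the index set `I`, and each `f i` plays the
role of `e` in one copy of `X`: sending `ψ(b) (f i) a` to `φ(b) e a` in the `i`-th summand preserves
inner products, because both sides are computed from `q b⋆ b' q`. These vectors are total in `Y` and
in `⨁_I X`, since `p` and `q` are full and `ψ` is nondegenerate (`span_translates_eq_top`,
`span_single_eq_top`). Hence the map extends to a unitary (`exists_unitary_of_inner_eq`), which
intertwines the actions because it does so on the generators. -/

lemma map_mem_of_mem_closure_span {E F : Type*} [NormedAddCommGroup E] [NormedSpace ℂ E]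
    [NormedAddCommGroup F] [NormedSpace ℂ F] (f : E →L[ℂ] F) {S : Set E} {N : Submodule ℂ F}
    (hN : IsClosed (N : Set F)) (h : ∀ s ∈ S, f s ∈ N) {x : E}
    (hx : x ∈ (Submodule.span ℂ S).topologicalClosure) : f x ∈ N := by
  have hle : (Submodule.span ℂ S).topologicalClosure ≤ N.comap (f : E →ₗ[ℂ] F) :=
    Submodule.topologicalClosure_minimal _ (Submodule.span_le.mpr h) (hN.preimage f.continuous)
  exact hle hx

/-- Compact operators between Hilbert spaces are norm limits of finite-rank operators. -/
lemma mem_closure_span_rankOne {H : Type*} [NormedAddCommGroup H] [InnerProductSpace ℂ H]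
    [CompleteSpace H] {T : H →L[ℂ] H} (hT : IsCompactOperator T) :
    T ∈ (Submodule.span ℂ
      {S : H →L[ℂ] H | ∃ x y, S = InnerProductSpace.rankOne ℂ x y}).topologicalClosure := by
  rw [← SetLike.mem_coe, Submodule.topologicalClosure_coe, Metric.mem_closure_iff]
  intro ε hε
  -- The centres of finitely many `ε/2`-balls covering the image of the unit ball span `V`;
  -- projecting onto `V` moves each `T x` with `‖x‖ = 1` by at most `ε/2`.
  have hc := hT.isCompact_closure_image_closedBall (f := (T : H →ₗ[ℂ] H)) 1
  obtain ⟨t, -, htf, hcov⟩ := hc.finite_cover_balls (half_pos hε)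
  let V := Submodule.span ℂ t
  have : FiniteDimensional ℂ V := FiniteDimensional.span_of_finite ℂ htf
  refine ⟨V.starProjection ∘L T, ?_, ?_⟩
  · have hb := (stdOrthonormalBasis ℂ V).starProjection_eq_sum_rankOne
    rw [hb, ContinuousLinearMap.finsetSum_comp]
    refine Submodule.sum_mem _ fun i _ => Submodule.subset_span ?_
    exact ⟨_, _, InnerProductSpace.rankOne_comp _ _ _⟩
  · rw [dist_eq_norm]
    refine lt_of_le_of_lt ?_ (half_lt_self hε)
    refine ContinuousLinearMap.opNorm_le_of_unit_norm (by positivity) fun x hx => ?_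
    have hx' : T x ∈ closure ((T : H →ₗ[ℂ] H) '' Metric.closedBall 0 1) :=
      subset_closure ⟨x, by simp [hx], rfl⟩
    obtain ⟨y, hy, hxy⟩ := Set.mem_iUnion₂.mp (hcov hx')
    have h2 : ‖T x - V.starProjection (T x)‖ ≤ ‖T x - y‖ := by
      rw [Submodule.starProjection_minimal]
      exact ciInf_le ⟨0, by rintro _ ⟨z, rfl⟩; positivity⟩ (⟨y, Submodule.subset_span hy⟩ : V)
    refine h2.trans ?_
    rw [← dist_eq_norm]
    exact (Metric.mem_ball.mp hxy).le

/-- A nonzero projection `p` with `p C p = ℂ p` which generates `C` as a closed two-sided ideal. -/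
structure IsMinimalFullProjection {C : Type*} [NonUnitalCStarAlgebra C] (p : C) : Prop where
  star_eq : star p = p
  mul_self : p * p = p
  ne_zero : p ≠ 0
  corner (c : C) : ∃ r : ℂ, p * c * p = r • p
  full (c : C) : c ∈ (Submodule.span ℂ {d : C | ∃ a b, d = a * p * b}).topologicalClosure

/-- The conditions are symmetric under reversing products; right `A`-modules are handled as modules
over `Aᵐᵒᵖ`. -/
lemma IsMinimalFullProjection.op {A : Type*} [NonUnitalCStarAlgebra A] {p : A}
    (hp : IsMinimalFullProjection p) : IsMinimalFullProjection (MulOpposite.op p) where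
  star_eq := by rw [← MulOpposite.op_star, hp.star_eq]
  mul_self := by rw [← MulOpposite.op_mul, hp.mul_self]
  ne_zero := by simpa using hp.ne_zero
  corner c := by
    obtain ⟨r, hr⟩ := hp.corner c.unop
    refine ⟨r, MulOpposite.unop_injective ?_⟩
    simpa [mul_assoc] using hr
  full c := by
    let f : A →L[ℂ] Aᵐᵒᵖ := (MulOpposite.opContinuousLinearEquiv ℂ : A ≃L[ℂ] Aᵐᵒᵖ)
    have h : ∀ a : A, f a ∈ (Submodule.span ℂ {d : Aᵐᵒᵖ | ∃ a b, d = a * MulOpposite.op p * b}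
        ).topologicalClosure := by
      intro a
      refine map_mem_of_mem_closure_span f (Submodule.isClosed_topologicalClosure _) ?_ (hp.full a)
      rintro _ ⟨a, b, rfl⟩
      refine Submodule.le_topologicalClosure _ (Submodule.subset_span ?_)
      exact ⟨.op b, .op a, by simp [f, mul_assoc]⟩
    simpa [f] using h c.unop

lemma IsElementary.exists_isMinimalFullProjection {A : Type u} [NonUnitalCStarAlgebra A]
    (hA : IsElementary.{u, v} A) : ∃ p : A, IsMinimalFullProjection p := by
  obtain ⟨H, _, _, _, π, hH, hinj, hrange⟩ := hA
  have hiso : Isometry π := NonUnitalStarAlgHom.isometry π hinj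
  obtain ⟨h, hh⟩ := exists_norm_eq H zero_le_one
  have hex : ∀ x y : H, ∃ a, π a = InnerProductSpace.rankOne ℂ x y := fun x y => by
    have : InnerProductSpace.rankOne ℂ x y ∈ Set.range π := by
      rw [hrange]
      exact (isCompactOperator_of_locallyCompactSpace_rng
        (ContinuousLinearMap.toSpanSingleton ℂ x)).comp_clm (innerSL ℂ y)
    exact this
  have hhh : ⟪h, h⟫_ℂ = 1 := by simp [inner_self_eq_norm_sq_to_K, hh]
  obtain ⟨p, hp⟩ := hex h h
  refine ⟨p, ?_, ?_, ?_, ?_, ?_⟩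
  · apply hinj
    rw [map_star, hp, ContinuousLinearMap.star_eq_adjoint, InnerProductSpace.adjoint_rankOne]
  · apply hinj
    rw [map_mul, hp]
    ext z
    simp [hh]
  · rintro rfl
    have := congrArg (fun T : H →L[ℂ] H => T h) hp
    have hh0 : h = 0 := by simpa [hhh] using this.symm
    simp [hh0] at hh
  · intro c
    refine ⟨⟪h, π c h⟫_ℂ, hinj ?_⟩
    rw [map_mul, map_mul, map_smul, hp]
    ext z
    simp [smul_smul, mul_comm]
  · intro c
    have hc : IsCompactOperator (π c) := by
      have : π c ∈ Set.range π := ⟨c, rfl⟩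
      rwa [hrange] at this
    have h1 := mem_closure_span_rankOne hc
    have h2 : Submodule.span ℂ {S : H →L[ℂ] H | ∃ x y, S = InnerProductSpace.rankOne ℂ x y} ≤
        -- Writing `x ⊗ y` for the operator `z ↦ ⟪y, z⟫ x`, one has `x ⊗ y = (x ⊗ h)(h ⊗ h)(h ⊗ y)`
        -- because `h` is a unit vector.
        (Submodule.span ℂ {d : A | ∃ a b, d = a * p * b}).map (π : A →ₗ[ℂ] (H →L[ℂ] H)) := by
      refine Submodule.span_le.mpr ?_
      rintro _ ⟨x, y, rfl⟩
      obtain ⟨a, ha⟩ := hex x h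
      obtain ⟨b, hb⟩ := hex h y
      refine ⟨a * p * b, Submodule.subset_span ⟨a, b, rfl⟩, ?_⟩
      change π (a * p * b) = _
      rw [map_mul, map_mul, ha, hb, hp]
      ext z
      simp [hh]
    rw [← SetLike.mem_coe, Submodule.topologicalClosure_coe] at h1 ⊢
    rw [hiso.isUniformInducing.isInducing.closure_eq_preimage_closure_image]
    exact closure_mono h2 h1

end HilbertModule

/-! ### Approximate units, unitaries from total families, and summands of `⨁_I X`. -/

namespace HilbertModule

open CStarModule

section Module

variable {C : Type u} [NonUnitalCStarAlgebra C] [PartialOrder C] [StarOrderedRing C]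
variable {X : Type v} [NormedAddCommGroup X] [NormedSpace ℂ X] [SMul C X] [CStarModule C X]
variable {Y : Type w} [NormedAddCommGroup Y] [NormedSpace ℂ Y] [SMul C Y] [CStarModule C Y]

lemma op_smul_mul (c d : C) (x : X) : (c * d) • x = c • (d • x) :=
  ext_inner C fun z => by simp [mul_assoc]

lemma op_smul_add_right (c : C) (x y : X) : c • (x + y) = c • x + c • y :=
  ext_inner C fun z => by simp [mul_add]

lemma op_smul_smul_complex (c : C) (r : ℂ) (x : X) : c • (r • x) = r • (c • x) :=
  ext_inner C fun z => by simp [mul_smul_comm]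

/-- The map `c ↦ c • x` as a bounded operator. -/
noncomputable def opSMulRight (x : X) : C →L[ℂ] X :=
  LinearMap.mkContinuous
    { toFun := fun c => c • x
      map_add' := fun c d => op_smul_add c d x
      map_smul' := fun r c => op_smul_complex r c x }
    ‖x‖ fun c => by rw [mul_comm]; exact norm_op_smul_le c x

@[simp] lemma opSMulRight_apply (x : X) (c : C) : opSMulRight x c = c • x := rfl

/-- The map `x ↦ c • x` as a bounded operator. -/
noncomputable def opSMulLeft (c : C) : X →L[ℂ] X :=
  LinearMap.mkContinuous
    { toFun := fun x => c • x
      map_add' := op_smul_add_right c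
      map_smul' := op_smul_smul_complex c }
    ‖c‖ (norm_op_smul_le c)

@[simp] lemma opSMulLeft_apply (x : X) (c : C) : opSMulLeft c x = c • x := rfl

open Filter Topology in
lemma tendsto_approximateUnit_op_smul (x : X) :
    Tendsto (fun c : C => c • x) (CStarAlgebra.approximateUnit C) (𝓝 x) := by
  have hl := CStarAlgebra.increasingApproximateUnit C
  -- Since eventually `‖c‖ ≤ 1`, expanding the inner product gives `‖c • x - x‖² ≤ 2 ‖c ⟪x, x⟫ - ⟪x,
  -- x⟫‖`.
  have hm : Tendsto (fun c : C => √(2 * ‖c * ⟪x, x⟫_C - ⟪x, x⟫_C‖))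
      (CStarAlgebra.approximateUnit C) (𝓝 0) := by
    have h1 := tendsto_iff_norm_sub_tendsto_zero.mp (hl.tendsto_mul_right ⟪x, x⟫_C)
    simpa using (h1.const_mul 2).sqrt
  rw [tendsto_iff_norm_sub_tendsto_zero]
  refine squeeze_zero' (Eventually.of_forall fun _ => norm_nonneg _) ?_ hm
  filter_upwards [hl.eventually_norm] with c hc
  refine Real.le_sqrt_of_sq_le ?_
  have e : ⟪c • x - x, c • x - x⟫_C =
      (c * ⟪x, x⟫_C - ⟪x, x⟫_C) * star c - (c * ⟪x, x⟫_C - ⟪x, x⟫_C) := by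
    simp only [CStarModule.inner_sub_left, CStarModule.inner_sub_right, inner_op_smul_left,
      inner_op_smul_right, sub_mul, mul_sub, mul_assoc]
    abel
  rw [norm_sq_eq C, e]
  refine (norm_sub_le _ _).trans ?_
  have := norm_mul_le (c * ⟪x, x⟫_C - ⟪x, x⟫_C) (star c)
  rw [norm_star] at this
  nlinarith [norm_nonneg (c * ⟪x, x⟫_C - ⟪x, x⟫_C)]

lemma mem_of_forall_op_smul_mem {N : Submodule ℂ X} (hN : IsClosed (N : Set X)) {x : X}
    (h : ∀ c : C, c • x ∈ N) : x ∈ N :=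
  have := (CStarAlgebra.increasingApproximateUnit C).neBot
  hN.mem_of_tendsto (tendsto_approximateUnit_op_smul (C := C) x) (Filter.Eventually.of_forall h)

/-- Fullness passes from the products `c p d` to all of `C`, and an approximate unit then recovers
`x`. All totality arguments below reduce to vectors `c • p • d • x` in this way; `N` need not be
stable under `C`. -/
lemma IsMinimalFullProjection.mem_of_forall {p : C} (hp : IsMinimalFullProjection p)
    {N : Submodule ℂ X} (hN : IsClosed (N : Set X)) {x : X}
    (h : ∀ c d : C, c • p • d • x ∈ N) : x ∈ N := by
  refine mem_of_forall_op_smul_mem (C := C) hN fun c => ?_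
  refine map_mem_of_mem_closure_span (opSMulRight x) hN ?_ (hp.full c)
  rintro _ ⟨a, b, rfl⟩
  simpa [op_smul_mul] using h a b

lemma norm_rankOne_le (x y : X) : ‖rankOne C x y‖ ≤ ‖y‖ * ‖x‖ :=
  LinearMap.mkContinuous_norm_le _ (by positivity) _

@[simp] lemma rankOne_apply (x y z : X) : rankOne C x y z = ⟪y, z⟫_C • x := rfl

variable (C) in
/-- The map `x ↦ θ_{x,y}` as a bounded operator. -/
noncomputable def rankOneLeft (y : X) : X →L[ℂ] (X →L[ℂ] X) :=
  LinearMap.mkContinuous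
    { toFun := fun x => rankOne C x y
      map_add' := fun x x' => by ext z; simp [op_smul_add_right]
      map_smul' := fun r x => by ext z; simp [op_smul_smul_complex] }
    ‖y‖ fun x => norm_rankOne_le x y

/-- Two total families with the same inner products are related by a unitary. -/
lemma exists_unitary_of_inner_eq [CompleteSpace X] [CompleteSpace Y] {ι : Type*} (s : ι → X)
    (t : ι → Y) (h : ∀ i j, ⟪s i, s j⟫_C = ⟪t i, t j⟫_C)
    (hs : (Submodule.span ℂ (Set.range s)).topologicalClosure = ⊤)
    (ht : (Submodule.span ℂ (Set.range t)).topologicalClosure = ⊤) :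
    ∃ U : X ≃ₗᵢ[ℂ] Y, (∀ i, U (s i) = t i) ∧ ∀ x y, ⟪U x, U y⟫_C = ⟪x, y⟫_C := by
  -- Equal inner products make `S u ↦ T u` isometric on formal combinations `u`, hence well defined
  -- on dense subspaces.
  let S := Finsupp.linearCombination ℂ s
  let T := Finsupp.linearCombination ℂ t
  have hST : ∀ u v, ⟪T u, T v⟫_C = ⟪S u, S v⟫_C := by
    intro u v
    simp only [S, T, Finsupp.linearCombination_apply, Finsupp.sum, inner_sum_left, inner_sum_right,
      inner_smul_left_complex, inner_smul_right_complex, h]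
  have hnorm : ∀ u, ‖T u‖ = ‖S u‖ := fun u => by
    rw [norm_eq_sqrt_norm_inner_self (A := C), norm_eq_sqrt_norm_inner_self (A := C) (S u), hST]
  have hSd : DenseRange S := by
    rw [DenseRange, ← LinearMap.coe_range, Finsupp.range_linearCombination,
      ← Submodule.dense_iff_topologicalClosure_eq_top] at *
    exact hs
  have hTd : DenseRange T := by
    rw [DenseRange, ← LinearMap.coe_range, Finsupp.range_linearCombination,
      ← Submodule.dense_iff_topologicalClosure_eq_top] at *
    exact ht
  let U : X ≃ₗᵢ[ℂ] Y :=
    (LinearEquiv.refl ℂ (ι →₀ ℂ)).extendOfIsometry S T hSd hTd hnorm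
  have hU : ∀ u, U (S u) = T u := fun u =>
    LinearMap.extendOfNorm_eq hSd ⟨1, fun v => by simpa using (hnorm v).le⟩ u
  refine ⟨U, fun i => by simpa [S, T] using hU (Finsupp.single i 1), fun x y => ?_⟩
  have hcX := continuous_inner (A := C) (E := X)
  have hcY := continuous_inner (A := C) (E := Y)
  refine hSd.induction_on₂ (p := fun x y => ⟪U x, U y⟫_C = ⟪x, y⟫_C) ?_ (fun u v => ?_) x y
  · exact isClosed_eq (hcY.comp (by fun_prop : Continuous fun q : X × X => (U q.1, U q.2))) hcX
  · rw [hU, hU, hST]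

namespace HilbertSum

variable {I : Type w}

open Classical in
/-- The inclusion of the `i`-th summand in the direct sum of copies of `X`. -/
noncomputable def single (i : I) : X →L[ℂ] HilbertSum C X I :=
  LinearMap.mkContinuous
    { toFun := fun x => mk (Pi.single i x) <|
        summable_of_ne_finset_zero (s := {i}) fun j hj => by
          rw [Pi.single_eq_of_ne (by simpa using hj), CStarModule.inner_zero_left]
      map_add' := fun x y => ext fun j => by
        rcases eq_or_ne j i with rfl | hj <;> simp [*]
      map_smul' := fun r x => ext fun j => by
        rcases eq_or_ne j i with rfl | hj <;> simp [*] }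
    1 fun x => by
      rw [one_mul, norm_eq_sqrt_norm_inner_self (A := C), norm_eq_sqrt_norm_inner_self (A := C) x,
        inner_def, tsum_eq_single i fun j hj => by simp [hj]]
      simp

@[simp] lemma single_apply_same (i : I) (x : X) : single (C := C) i x i = x := by
  classical exact Pi.single_eq_same (M := fun _ => X) i x

lemma single_apply_of_ne {i j : I} (h : j ≠ i) (x : X) : single (C := C) i x j = 0 := by
  classical exact Pi.single_eq_of_ne (M := fun _ => X) h x

lemma inner_single_left (i : I) (x : X) (y : HilbertSum C X I) :
    ⟪single i x, y⟫_C = ⟪x, y i⟫_C := by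
  rw [inner_def, tsum_eq_single i fun j hj => by simp [single_apply_of_ne hj], single_apply_same]

lemma coord_sum (s : Finset I) (f : I → HilbertSum C X I) (j : I) :
    (∑ i ∈ s, f i) j = ∑ i ∈ s, f i j := by
  classical
  induction s using Finset.induction_on with
  | empty => simp
  | insert a s ha ih => simp [Finset.sum_insert ha, ih]

lemma hasSum_single (x : HilbertSum C X I) : HasSum (fun i => single (C := C) i (x i)) x := by
  classical
  rw [HasSum, tendsto_iff_norm_sub_tendsto_zero]
  have hsum := summable_inner_self x
  -- Pythagoras: the squared distance to a partial sum is the norm of the remainder of the series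
  -- for `⟪x, x⟫`.
  have key : ∀ s : Finset I, ‖∑ i ∈ s, single (C := C) i (x i) - x‖ =
      √‖⟪x, x⟫_C - ∑ i ∈ s, ⟪x i, x i⟫_C‖ := by
    intro s
    rw [norm_eq_sqrt_norm_inner_self (A := C)]
    congr 2
    have e1 : ⟪∑ i ∈ s, single (C := C) i (x i), ∑ i ∈ s, single (C := C) i (x i)⟫_C
        = ∑ i ∈ s, ⟪x i, x i⟫_C := by
      rw [inner_sum_left]
      refine Finset.sum_congr rfl fun i hi => ?_
      rw [inner_single_left, coord_sum, Finset.sum_eq_single i, single_apply_same]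
      · exact fun j _ hj => single_apply_of_ne hj.symm _
      · exact fun h => (h hi).elim
    have e2 : ⟪∑ i ∈ s, single (C := C) i (x i), x⟫_C = ∑ i ∈ s, ⟪x i, x i⟫_C := by
      rw [inner_sum_left]
      exact Finset.sum_congr rfl fun i hi => inner_single_left i _ _
    have e3 : ⟪x, ∑ i ∈ s, single (C := C) i (x i)⟫_C = ∑ i ∈ s, ⟪x i, x i⟫_C := by
      rw [← star_inner, e2, star_sum]
      simp
    rw [CStarModule.inner_sub_left, CStarModule.inner_sub_right, CStarModule.inner_sub_right,
      e1, e2, e3]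
    abel
  simp only [key]
  have h := (hsum.hasSum.const_sub ⟪x, x⟫_C).norm.sqrt
  simpa [← inner_def] using h

end HilbertSum

end Module

end HilbertModule

/-! ### The Hilbert space cut out of a module by a minimal projection. -/

namespace HilbertModule

open CStarModule

section Corner

variable {C : Type u} [NonUnitalCStarAlgebra C] [PartialOrder C] [StarOrderedRing C]
variable {Y : Type w} [NormedAddCommGroup Y] [NormedSpace ℂ Y] [SMul C Y] [CStarModule C Y]

namespace IsMinimalFullProjection

lemma smul_injective {p : C} (hp : IsMinimalFullProjection p) :
    Function.Injective fun r : ℂ => r • p :=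
  smul_left_injective ℂ hp.ne_zero

lemma norm_eq_one {p : C} (hp : IsMinimalFullProjection p) : ‖p‖ = 1 := by
  have h := CStarRing.norm_star_mul_self (x := p)
  rw [hp.star_eq, hp.mul_self] at h
  exact (mul_eq_left₀ (norm_ne_zero_iff.mpr hp.ne_zero)).mp h.symm

/-- Self-adjointness makes `r` real, and a negative `r` would make `r • p` both `≤ 0` and `≥ 0`.
This is the positivity of the scalar product on the corner. -/
lemma eq_norm_of_smul_nonneg {p : C} (hp : IsMinimalFullProjection p) {r : ℂ}
    (hr : 0 ≤ r • p) : r = (‖r‖ : ℂ) := by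
  have h1 : star r = r := hp.smul_injective <| by
    simpa [hp.star_eq] using hr.isSelfAdjoint.star_eq
  obtain ⟨s, rfl⟩ : ∃ s : ℝ, (s : ℂ) = r := ⟨r.re, Complex.conj_eq_iff_re.mp h1⟩
  rcases le_total 0 s with hs | hs
  · simp [abs_of_nonneg hs]
  · have hp0 : 0 ≤ p := by
      have := star_mul_self_nonneg p
      rwa [hp.star_eq, hp.mul_self] at this
    have h2 : (s : ℂ) • p ≤ 0 := by
      rw [Complex.coe_smul]
      exact smul_nonpos_of_nonpos_of_nonneg hs hp0
    have h3 := le_antisymm h2 hr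
    have h4 : (s : ℂ) = 0 := (smul_eq_zero.mp h3).resolve_right hp.ne_zero
    simp [h4]

/-- If `p` acts as the identity on a closed subspace `K`, then `K` has an orthonormal basis for the
scalar product determined by `⟪x, y⟫ = r • p`. -/
lemma exists_orthonormal_basis [CompleteSpace Y] {p : C} (hp : IsMinimalFullProjection p)
    {K : Submodule ℂ Y} (hK : IsClosed (K : Set Y)) (hpK : ∀ y ∈ K, p • y = y) :
    ∃ (I : Type w) (f : I → Y), (∀ i, f i ∈ K) ∧ (∀ i, ⟪f i, f i⟫_C = p) ∧
      (∀ i j, i ≠ j → ⟪f i, f j⟫_C = 0) ∧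
      ∀ y ∈ K, y ∈ (Submodule.span ℂ (Set.range f)).topologicalClosure := by
  have hr : ∀ x y : K, ∃ r : ℂ, ⟪(x : Y), (y : Y)⟫_C = r • p := by
    intro x y
    obtain ⟨r, h⟩ := hp.corner ⟪(x : Y), (y : Y)⟫_C
    refine ⟨r, ?_⟩
    -- As `p` fixes `x` and `y`, `⟪x, y⟫ = ⟪p • x, p • y⟫ = p ⟪x, y⟫ p`.
    rw [← h, mul_assoc]
    conv_rhs => rw [← hp.star_eq]
    rw [← inner_op_smul_left, hp.star_eq, ← inner_op_smul_right, hpK _ x.2, hpK _ y.2]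
  choose r hr using hr
  have : CompleteSpace K := hK.completeSpace_coe
  -- The norm of `K` is the one inherited from `Y`: it matches this scalar product because `‖p‖ =
  -- 1`, so completeness carries over.
  let _ : InnerProductSpace ℂ K :=
    { inner := r
      norm_sq_eq_re_inner := fun x => by
        have h0 : 0 ≤ r x x • p := hr x x ▸ CStarModule.inner_self_nonneg
        change ‖(x : Y)‖ ^ 2 = _
        rw [norm_sq_eq C, hr, norm_smul, hp.norm_eq_one, mul_one, hp.eq_norm_of_smul_nonneg h0]
        simp
      conj_inner_symm := fun x y => hp.smul_injective <| by
        have h : star ⟪(y : Y), (x : Y)⟫_C = ⟪(x : Y), (y : Y)⟫_C := star_inner _ _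
        rw [hr, hr, star_smul, hp.star_eq] at h
        exact h
      add_left := fun x y z => hp.smul_injective <| by
        simp only [add_smul, ← hr]
        simp
      smul_left := fun x y s => hp.smul_injective <| by
        simp only [mul_smul, ← hr]
        simp }
  obtain ⟨s, b, hb⟩ := exists_hilbertBasis ℂ K
  refine ⟨s, fun i => (b i : Y), fun i => (b i).2, fun i => ?_, fun i j hij => ?_, fun y hy => ?_⟩
  · have h : r (b i) (b i) = 1 := by
      classical
      have := (orthonormal_iff_ite.mp b.orthonormal) i i
      rwa [if_pos rfl] at this
    rw [hr, h, one_smul]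
  · have h : r (b i) (b j) = 0 := b.orthonormal.2 hij
    rw [hr, h, zero_smul]
  · have hd : (⟨y, hy⟩ : K) ∈ (Submodule.span ℂ (Set.range b)).topologicalClosure := by
      rw [b.dense_span]; trivial
    refine map_mem_of_mem_closure_span K.subtypeL (Submodule.isClosed_topologicalClosure _) ?_ hd
    rintro _ ⟨i, rfl⟩
    exact Submodule.le_topologicalClosure _ (Submodule.subset_span ⟨i, rfl⟩)

lemma exists_inner_self_eq [CompleteSpace Y] [Nontrivial Y] {p : C}
    (hp : IsMinimalFullProjection p) : ∃ e : Y, ⟪e, e⟫_C = p ∧ p • e = e := by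
  let K : Submodule ℂ Y := (opSMulLeft p - .id ℂ Y : Y →L[ℂ] Y).ker
  have hmem : ∀ {y}, y ∈ K ↔ p • y = y := by simp [K, sub_eq_zero]
  obtain ⟨I, f, hfK, hf, -, hd⟩ :=
    hp.exists_orthonormal_basis (K := K) (ContinuousLinearMap.isClosed_ker _) fun y => hmem.mp
  rcases isEmpty_or_nonempty I with hI | ⟨⟨i⟩⟩
  -- An empty basis would mean that `p` annihilates `Y`, and fullness of `p` would then give `Y =
  -- 0`.
  · obtain ⟨y, hy⟩ := exists_ne (0 : Y)
    refine (hy ?_).elim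
    have hK0 : ∀ y ∈ K, y = 0 := fun y hy => by
      have h := hd y hy
      rwa [Set.range_eq_empty, Submodule.span_empty,
        IsClosed.submodule_topologicalClosure_eq isClosed_singleton] at h
    have h0 : ∀ y : Y, p • y = 0 := fun y => hK0 _ <| hmem.mpr <| by
      rw [← op_smul_mul, hp.mul_self]
    refine hp.mem_of_forall (N := ⊥) isClosed_singleton fun c d => ?_
    rw [h0]
    exact (opSMulLeft c : Y →L[ℂ] Y).map_zero
  · exact ⟨f i, hf i, hmem.mp (hfK i)⟩

end IsMinimalFullProjection

end Corner

/-! ### Transporting the minimal full projection from `A` to `B`. -/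

section Correspondence

variable {B : Type u'} {A : Type u} [NonUnitalCStarAlgebra B] [NonUnitalCStarAlgebra A]
  [PartialOrder A] [StarOrderedRing A]
variable {X : Type v} [NormedAddCommGroup X] [NormedSpace ℂ X] [SMul Aᵐᵒᵖ X] [CStarModule Aᵐᵒᵖ X]
variable {Y : Type w} [NormedAddCommGroup Y] [NormedSpace ℂ Y] [SMul Aᵐᵒᵖ Y] [CStarModule Aᵐᵒᵖ Y]

namespace AdjointableRep

variable (φ : AdjointableRep B A X)

/-- Having an adjoint forces linearity over `A`. -/
lemma map_op_smul (b : B) (c : Aᵐᵒᵖ) (x : X) : φ.toHom b (c • x) = c • φ.toHom b x :=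
  ext_inner Aᵐᵒᵖ fun z => by
    rw [inner_op_smul_right, ← star_star b, ← φ.inner_left, ← φ.inner_left, inner_op_smul_right]

lemma inner_map_map (b b' : B) (x y : X) :
    ⟪φ.toHom b x, φ.toHom b' y⟫_Aᵐᵒᵖ = ⟪x, φ.toHom (star b * b') y⟫_Aᵐᵒᵖ := by
  rw [φ.inner_left, map_mul, mul_apply_eq_comp]

lemma norm_toHom_apply_le (b : B) (x : X) : ‖φ.toHom b x‖ ≤ ‖b‖ * ‖x‖ := by
  refine (sq_le_sq₀ (norm_nonneg _) (by positivity)).mp ?_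
  have e : ‖b‖ ^ 2 * ‖⟪x, x⟫_Aᵐᵒᵖ‖ = ‖(‖b‖ ^ 2) • ⟪x, x⟫_Aᵐᵒᵖ‖ := by
    rw [norm_smul, Real.norm_of_nonneg (sq_nonneg ‖b‖)]
  rw [mul_pow, norm_sq_eq Aᵐᵒᵖ, norm_sq_eq Aᵐᵒᵖ (x := x), e]
  exact CStarAlgebra.norm_le_norm_of_nonneg_of_le CStarModule.inner_self_nonneg
    (φ.inner_self_le b x)

/-- The representation as a bounded linear map. -/
noncomputable def toCLM : B →L[ℂ] (X →L[ℂ] X) :=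
  LinearMap.mkContinuous (φ.toHom : B →ₗ[ℂ] (X →L[ℂ] X)) 1 fun b => by
    rw [one_mul]
    exact ContinuousLinearMap.opNorm_le_bound _ (norm_nonneg b) (φ.norm_toHom_apply_le b)

@[simp] lemma toCLM_apply (b : B) : φ.toCLM b = φ.toHom b := rfl

lemma map_star_eq_rankOne {b : B} {x y : X} (h : φ.toHom b = rankOne Aᵐᵒᵖ x y) :
    φ.toHom (star b) = rankOne Aᵐᵒᵖ y x := by
  ext z
  refine ext_inner Aᵐᵒᵖ fun z' => ?_
  rw [← φ.inner_left, h, rankOne_apply, rankOne_apply, inner_op_smul_left, inner_op_smul_right,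
    star_inner]

end AdjointableRep

namespace Correspondence

variable {φ : Correspondence B A X} {p : Aᵐᵒᵖ} {e : X} {q : B}

lemma IsImprimitivityBimodule.exists_toHom_eq_rankOne (hφ : φ.IsImprimitivityBimodule) (x y : X) :
    ∃ b, φ.toHom b = rankOne Aᵐᵒᵖ x y := by
  have h : rankOne Aᵐᵒᵖ x y ∈ (compacts Aᵐᵒᵖ X : Set (X →L[ℂ] X)) :=
    Submodule.le_topologicalClosure _ (Submodule.subset_span ⟨x, y, rfl⟩)
  rwa [← hφ.2] at h

lemma IsImprimitivityBimodule.star_eq_self (hφ : φ.IsImprimitivityBimodule)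
    (hq : φ.toHom q = rankOne Aᵐᵒᵖ e e) : star q = q :=
  hφ.1 ((φ.map_star_eq_rankOne hq).trans hq.symm)

lemma IsImprimitivityBimodule.mul_self (hφ : φ.IsImprimitivityBimodule)
    (hq : φ.toHom q = rankOne Aᵐᵒᵖ e e) (he : ⟪e, e⟫_Aᵐᵒᵖ = p) (hpe : p • e = e) : q * q = q :=
  hφ.1 <| by
    ext z
    simp [hq, he, op_smul_mul, hpe]

/-- Compressing `φ(b)` by `θ_{e,e}` multiplies `θ_{e,e}` by the scalar of `⟪e, φ(b) e⟫`, and `φ` is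
injective. The shared `r` is what transfers inner products from `X` to `Y`. -/
lemma IsImprimitivityBimodule.exists_corner (hφ : φ.IsImprimitivityBimodule)
    (hp : IsMinimalFullProjection p) (hq : φ.toHom q = rankOne Aᵐᵒᵖ e e) (hpe : p • e = e) (b : B) :
    ∃ r : ℂ, q * b * q = r • q ∧ ⟪e, φ.toHom b e⟫_Aᵐᵒᵖ = r • p := by
  obtain ⟨r, hr⟩ := hp.corner ⟪e, φ.toHom b e⟫_Aᵐᵒᵖ
  have h : ⟪e, φ.toHom b e⟫_Aᵐᵒᵖ = r • p := by
    rw [← hr, mul_assoc]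
    conv_rhs => rw [← hp.star_eq]
    rw [← inner_op_smul_left, hp.star_eq, ← inner_op_smul_right, ← φ.map_op_smul, hpe]
  refine ⟨r, hφ.1 ?_, h⟩
  ext z
  simp [hq, h, φ.map_op_smul, op_smul_mul, op_smul_complex, op_smul_smul_complex, hpe]

/-- Fullness of `q` in `B`: products `a q c` already produce the operators `θ_{c • p • d • x, y}`,
and fullness of `p` yields every `θ_{x,y}`. -/
lemma IsImprimitivityBimodule.mem_closure_span [CompleteSpace X]
    (hφ : φ.IsImprimitivityBimodule) (hp : IsMinimalFullProjection p)
    (hq : φ.toHom q = rankOne Aᵐᵒᵖ e e) (he : ⟪e, e⟫_Aᵐᵒᵖ = p) (hpe : p • e = e) (b : B) :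
    b ∈ (Submodule.span ℂ {d : B | ∃ a c, d = a * q * c}).topologicalClosure := by
  set D := (Submodule.span ℂ {d : B | ∃ a c, d = a * q * c}).topologicalClosure with hD
  have hinj : Function.Injective φ.toCLM := hφ.1
  have hrange : Set.range φ.toCLM = (compacts Aᵐᵒᵖ X : Set (X →L[ℂ] X)) := hφ.2
  have hclosed : IsClosed (Set.range φ.toCLM) := by
    rw [hrange]; exact Submodule.isClosed_topologicalClosure _
  obtain ⟨K, hK⟩ := φ.toCLM.antilipschitz_of_injective_of_isClosed_range hinj hclosed
  -- `φ` is injective with closed range, hence bounded below, so the image of the closed ideal stays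
  -- closed.
  let M : Submodule ℂ (X →L[ℂ] X) := D.map (φ.toCLM : B →ₗ[ℂ] (X →L[ℂ] X))
  have hM : IsClosed (M : Set (X →L[ℂ] X)) :=
    (hK.isClosedEmbedding φ.toCLM.uniformContinuous).isClosedMap _
      (Submodule.isClosed_topologicalClosure _)
  have hθ : ∀ x y : X, rankOne Aᵐᵒᵖ x y ∈ M := by
    intro x y
    refine hp.mem_of_forall (N := M.comap (rankOneLeft Aᵐᵒᵖ y : X →ₗ[ℂ] (X →L[ℂ] X)))
      (hM.preimage (rankOneLeft Aᵐᵒᵖ y).continuous) (x := x) fun c d => ?_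
    -- `θ_{d • x, e} θ_{e,e} θ_{e, c⋆ • y} = θ_{c • p • d • x, y}`.
    obtain ⟨a, ha⟩ := hφ.exists_toHom_eq_rankOne (d • x) e
    obtain ⟨a', ha'⟩ := hφ.exists_toHom_eq_rankOne e (star c • y)
    refine ⟨a * q * a', Submodule.le_topologicalClosure _ (Submodule.subset_span ⟨a, a', rfl⟩), ?_⟩
    change φ.toHom (a * q * a') = rankOne Aᵐᵒᵖ (c • p • d • x) y
    ext z
    simp [ha, ha', hq, op_smul_mul, he, hpe]
  have hle : compacts Aᵐᵒᵖ X ≤ M := by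
    refine Submodule.topologicalClosure_minimal _ (Submodule.span_le.mpr ?_) hM
    rintro _ ⟨x, y, rfl⟩
    exact hθ x y
  have hb : φ.toCLM b ∈ (compacts Aᵐᵒᵖ X : Set (X →L[ℂ] X)) := hrange ▸ ⟨b, rfl⟩
  obtain ⟨d, hd, hdb⟩ := hle hb
  rwa [← hinj hdb]

end Correspondence

end Correspondence

end HilbertModule

/-! ### Total families in `Y` and `⨁_I X`, and the isomorphism. -/

namespace HilbertModule

open CStarModule

section Multiple

variable {B : Type u'} {A : Type u} [NonUnitalCStarAlgebra B] [NonUnitalCStarAlgebra A]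
  [PartialOrder A] [StarOrderedRing A]
variable {X : Type v} [NormedAddCommGroup X] [NormedSpace ℂ X] [SMul Aᵐᵒᵖ X] [CStarModule Aᵐᵒᵖ X]
variable {Y : Type w} [NormedAddCommGroup Y] [NormedSpace ℂ Y] [SMul Aᵐᵒᵖ Y] [CStarModule Aᵐᵒᵖ Y]

namespace Correspondence

variable {φ : Correspondence B A X} {ψ : Correspondence B A Y} {p : Aᵐᵒᵖ} {e : X} {q : B}

/-- If `X = 0`, no vector `e` exists; but then `B = 0`, and nondegeneracy gives `Y = 0`, the empty
sum. -/
lemma IsImprimitivityBimodule.isMultipleOf_of_subsingleton [Subsingleton X]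
    (hφ : φ.IsImprimitivityBimodule) (ψ : Correspondence B A Y) : ψ.IsMultipleOf φ := by
  have hB : ∀ b : B, b = 0 := fun b => hφ.1 (Subsingleton.elim _ _)
  have hY : Subsingleton Y := by
    refine subsingleton_of_forall_eq 0 fun y => ?_
    obtain ⟨b, x, h⟩ := Set.eq_univ_iff_forall.mp ψ.nondegenerate y
    rw [h, hB b, map_zero, zero_apply]
  have hS : Subsingleton (HilbertSum Aᵐᵒᵖ X PEmpty.{w + 1}) :=
    ⟨fun x y => HilbertSum.ext fun i => i.elim⟩
  exact ⟨PEmpty, ⟨{ (0 : Y ≃ₗ[ℂ] HilbertSum Aᵐᵒᵖ X PEmpty.{w + 1}) with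
    inner_map := fun x y => by
      rw [Subsingleton.elim x 0]
      simp
    map_rep := fun b x => Subsingleton.elim _ _ }⟩⟩

/-- The translates `c • φ(b) e`, in all the summands, are total in the direct sum. -/
lemma IsImprimitivityBimodule.span_single_eq_top (hφ : φ.IsImprimitivityBimodule)
    (hp : IsMinimalFullProjection p) (he : ⟪e, e⟫_Aᵐᵒᵖ = p) (I : Type w) :
    (Submodule.span ℂ (Set.range fun k : I × B × Aᵐᵒᵖ =>
      HilbertSum.single (C := Aᵐᵒᵖ) k.1 (k.2.2 • φ.toHom k.2.1 e))).topologicalClosure = ⊤ := by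
  set N := (Submodule.span ℂ (Set.range fun k : I × B × Aᵐᵒᵖ =>
    HilbertSum.single (C := Aᵐᵒᵖ) k.1 (k.2.2 • φ.toHom k.2.1 e))).topologicalClosure
  have hN : IsClosed (N : Set (HilbertSum Aᵐᵒᵖ X I)) := Submodule.isClosed_topologicalClosure _
  have hsingle : ∀ (i : I) (x : X), HilbertSum.single i x ∈ N := by
    intro i x
    let f := HilbertSum.single (C := Aᵐᵒᵖ) (X := X) i
    refine hp.mem_of_forall (N := N.comap (f : X →ₗ[ℂ] HilbertSum Aᵐᵒᵖ X I))
      (hN.preimage f.continuous) (x := x) fun c d => ?_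
    -- `θ_{d • x, e}` sends `e` to `p • d • x`.
    obtain ⟨b, hb⟩ := hφ.exists_toHom_eq_rankOne (d • x) e
    refine Submodule.le_topologicalClosure _ (Submodule.subset_span ⟨(i, b, c), ?_⟩)
    change HilbertSum.single i (c • φ.toHom b e) = HilbertSum.single i (c • p • d • x)
    rw [hb, rankOne_apply, he]
  refine eq_top_iff.mpr fun x _ => ?_
  exact hN.mem_of_tendsto (HilbertSum.hasSum_single x)
    (Filter.Eventually.of_forall fun s => Submodule.sum_mem _ fun i _ => hsingle i (x i))

/-- If `f` is total in `ψ(q) Y p`, then its translates `c • ψ(b) (f i)` are total in `Y`. -/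
lemma IsImprimitivityBimodule.span_translates_eq_top [CompleteSpace X]
    (hφ : φ.IsImprimitivityBimodule) (ψ : Correspondence B A Y)
    (hp : IsMinimalFullProjection p) (hq : φ.toHom q = rankOne Aᵐᵒᵖ e e) (he : ⟪e, e⟫_Aᵐᵒᵖ = p)
    (hpe : p • e = e) {I : Type w} {f : I → Y}
    (hf : ∀ y, p • y = y → ψ.toHom q y = y →
      y ∈ (Submodule.span ℂ (Set.range f)).topologicalClosure) :
    (Submodule.span ℂ (Set.range fun k : I × B × Aᵐᵒᵖ =>
      k.2.2 • ψ.toHom k.2.1 (f k.1))).topologicalClosure = ⊤ := by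
  set N := (Submodule.span ℂ (Set.range fun k : I × B × Aᵐᵒᵖ =>
    k.2.2 • ψ.toHom k.2.1 (f k.1))).topologicalClosure
  have hN : IsClosed (N : Set Y) := Submodule.isClosed_topologicalClosure _
  have hqq : ∀ y, ψ.toHom q (ψ.toHom q y) = ψ.toHom q y := fun y => by
    rw [← mul_apply_eq_comp, ← map_mul, hφ.mul_self hq he hpe]
  have hbq : ∀ (b : B) (y : Y), ψ.toHom b (ψ.toHom q y) ∈ N := by
    intro b y
    let g : Y →L[ℂ] Y := ψ.toHom b ∘L ψ.toHom q
    refine hp.mem_of_forall (N := N.comap (g : Y →ₗ[ℂ] Y)) (hN.preimage g.continuous)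
      (x := y) fun c d => ?_
    change ψ.toHom b (ψ.toHom q (c • p • d • y)) ∈ N
    rw [ψ.map_op_smul, ψ.map_op_smul]
    -- The actions of `q` and `p` commute, so this vector is fixed by both.
    have hk := hf (ψ.toHom q (p • d • y))
      (by rw [← ψ.map_op_smul, ← op_smul_mul, hp.mul_self]) (hqq _)
    refine map_mem_of_mem_closure_span (opSMulLeft c ∘L ψ.toHom b) hN ?_ hk
    rintro _ ⟨i, rfl⟩
    exact Submodule.le_topologicalClosure _ (Submodule.subset_span ⟨(i, b, c), rfl⟩)
  refine eq_top_iff.mpr fun y _ => ?_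
  obtain ⟨b, x, rfl⟩ := Set.eq_univ_iff_forall.mp ψ.nondegenerate y
  -- Fullness of `q` reduces `ψ(b) x` to `ψ(a) ψ(q) ψ(c) x`.
  refine map_mem_of_mem_closure_span (ψ.toCLM.flip x) hN ?_ (hφ.mem_closure_span hp hq he hpe b)
  rintro _ ⟨a, c, rfl⟩
  simpa using hbq a (ψ.toHom c x)

theorem IsImprimitivityBimodule.isMultipleOf [CompleteSpace X] [CompleteSpace Y] [Nontrivial X]
    (hφ : φ.IsImprimitivityBimodule) (hp : IsMinimalFullProjection p) (ψ : Correspondence B A Y) :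
    ψ.IsMultipleOf φ := by
  obtain ⟨e, he, hpe⟩ := hp.exists_inner_self_eq (Y := X)
  obtain ⟨q, hq⟩ := hφ.exists_toHom_eq_rankOne e e
  have hqs := hφ.star_eq_self hq
  let K : Submodule ℂ Y :=
    (opSMulLeft p - .id ℂ Y : Y →L[ℂ] Y).ker ⊓ (ψ.toHom q - .id ℂ Y : Y →L[ℂ] Y).ker
  have hmem : ∀ {y}, y ∈ K ↔ p • y = y ∧ ψ.toHom q y = y := by simp [K, sub_eq_zero]
  have hK : IsClosed (K : Set Y) :=
    (ContinuousLinearMap.isClosed_ker _).inter (ContinuousLinearMap.isClosed_ker _)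
  obtain ⟨I, f, hfK, hfp, hf0, hfd⟩ := hp.exists_orthonormal_basis hK fun y hy => (hmem.mp hy).1
  let s : I × B × Aᵐᵒᵖ → HilbertSum Aᵐᵒᵖ X I :=
    fun k => HilbertSum.single k.1 (k.2.2 • φ.toHom k.2.1 e)
  let t : I × B × Aᵐᵒᵖ → Y := fun k => k.2.2 • ψ.toHom k.2.1 (f k.1)
  have hs : (Submodule.span ℂ (Set.range s)).topologicalClosure = ⊤ :=
    hφ.span_single_eq_top hp he I
  have ht : (Submodule.span ℂ (Set.range t)).topologicalClosure = ⊤ :=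
    hφ.span_translates_eq_top ψ hp hq he hpe fun y h1 h2 => hfd y (hmem.mpr ⟨h1, h2⟩)
  have hts : ∀ k l, ⟪t k, t l⟫_Aᵐᵒᵖ = ⟪s k, s l⟫_Aᵐᵒᵖ := by
    rintro ⟨i, b, c⟩ ⟨j, b', c'⟩
    obtain ⟨r, hr, hre⟩ := hφ.exists_corner hp hq hpe (star b * b')
    -- Since `ψ(q)` fixes each `f i`, only the compression `q (b⋆ b') q = r q` matters.
    have h1 : ⟪ψ.toHom b (f i), ψ.toHom b' (f j)⟫_Aᵐᵒᵖ = r • ⟪f i, f j⟫_Aᵐᵒᵖ := by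
      have hi := (hmem.mp (hfK i)).2
      have hj := (hmem.mp (hfK j)).2
      calc ⟪ψ.toHom b (f i), ψ.toHom b' (f j)⟫_Aᵐᵒᵖ
          = ⟪ψ.toHom q (f i), ψ.toHom (star b * b') (ψ.toHom q (f j))⟫_Aᵐᵒᵖ := by
            rw [ψ.inner_map_map, hi, hj]
        _ = ⟪f i, ψ.toHom (q * (star b * b') * q) (f j)⟫_Aᵐᵒᵖ := by
            rw [ψ.inner_left, hqs]
            simp only [map_mul, mul_apply_eq_comp]
        _ = r • ⟪f i, f j⟫_Aᵐᵒᵖ := by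
            rw [hr, map_smul, smul_apply, inner_smul_right_complex, hj]
    simp only [s, t, HilbertSum.inner_single_left, inner_op_smul_left, inner_op_smul_right, h1]
    rcases eq_or_ne i j with rfl | hij
    · rw [HilbertSum.single_apply_same, inner_op_smul_right, hfp, φ.inner_map_map, hre,
        mul_assoc]
    · rw [HilbertSum.single_apply_of_ne hij, hf0 i j hij]
      simp
  obtain ⟨U, hU, hUi⟩ := exists_unitary_of_inner_eq t s hts ht hs
  refine ⟨I, ⟨{ U.toLinearEquiv with inner_map := hUi, map_rep := fun b y => ?_ }⟩⟩
  let Uc : Y →L[ℂ] HilbertSum Aᵐᵒᵖ X I := U.toContinuousLinearEquiv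
  have hext : Uc ∘L ψ.toHom b = (φ.sum I).toHom b ∘L Uc := by
    refine ContinuousLinearMap.ext_on
      ((Submodule.dense_iff_topologicalClosure_eq_top).mpr ht) ?_
    rintro _ ⟨⟨i, b', c⟩, rfl⟩
    -- `B` permutes the generators by left multiplication on the middle index, in both modules
    -- alike.
    have h1 : ψ.toHom b (t (i, b', c)) = t (i, b * b', c) := by
      simp only [t, ψ.map_op_smul, map_mul, mul_apply_eq_comp]
    change U (ψ.toHom b (t (i, b', c))) = (φ.sum I).toHom b (U (t (i, b', c)))
    rw [h1, hU, hU]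
    ext j
    rw [AdjointableRep.sum_apply]
    rcases eq_or_ne j i with rfl | hj
    · simp only [s, HilbertSum.single_apply_same, φ.map_op_smul, map_mul, mul_apply_eq_comp]
    · simp only [s, HilbertSum.single_apply_of_ne hj, map_zero]
  exact congrArg (fun T => T y) hext

end Correspondence

end Multiple

end HilbertModule

theorem mainTheorem1 {A : Type u} [NonUnitalCStarAlgebra A] [PartialOrder A] [StarOrderedRing A]
    {B : Type u'} [NonUnitalCStarAlgebra B]
    (hA : HilbertModule.IsElementary.{u, v'} A)
    {X : Type v} [NormedAddCommGroup X] [NormedSpace ℂ X] [SMul Aᵐᵒᵖ X] [CStarModule Aᵐᵒᵖ X]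
    [CompleteSpace X] (φ : HilbertModule.Correspondence B A X) (hφ : φ.IsImprimitivityBimodule)
    {Y : Type w} [NormedAddCommGroup Y] [NormedSpace ℂ Y] [SMul Aᵐᵒᵖ Y] [CStarModule Aᵐᵒᵖ Y]
    [CompleteSpace Y] (ψ : HilbertModule.Correspondence B A Y) :
    ψ.IsMultipleOf φ := by
  obtain ⟨p, hp⟩ := hA.exists_isMinimalFullProjection
  rcases subsingleton_or_nontrivial X with hX | hX
  · exact hφ.isMultipleOf_of_subsingleton ψ
  · exact hφ.isMultipleOf hp.op ψ
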